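/- Let $\mathcal P_2(\mathbb R)$ be the set of Borel probability measures on $\mathbb R$ with finite second moment, equipped with the distance $W_2(\mu,\nu)=\big(\inf_{\gamma}\int |x-y|^2\,\mathrm d\gamma(x,y)\big)^{1/2}$, the infimum being over all couplings $\gamma$ of $\mu$ and $\nu$. A geodesic ray is a curve $(\nu_t)_{t\ge 0}$ in $\mathcal P_2(\mathbb R)$ with $W_2(\nu_t,\nu_s)=|t-s|\,W_2(\nu_0,\nu_1)$ for all $s,t\ge 0$ (speed $0$ is allowed). Let $\mu_0,\mu_1\in\mathcal P_2(\mathbb R)$ have cumulative distribution functions $F_0,F_1$ and quantile functions $F_i^{-1}(p)=\inf\{x\in\mathbb R: F_i(x)\ge p\}$, $p\in(0,1)$. Let $\gamma=(F_0^{-1},F_1^{-1})_\#\mathrm{Unif}([0,1])$ and, for $t\in\mathbb R$, let $\mu_t$ be the image of $\gamma$ under $(x,y)\mapsto(1-t)x+ty$; the curve $(\mu_t)_{t\in[0,1]}$ is the geodesic between $\mu_0$ and $\mu_1$. Then the following are equivalent: 1. the geodesic $(\mu_t)_{t\in[0,1]}$ extends to a geodesic ray, i.e. there is a geodesic ray $(\nu_t)_{t\ge0}$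 with $\nu_t=\mu_t$ for all $t\in[0,1]$; 2. the curve $(\mu_t)_{t\ge 0}$ is itself a geodesic ray; 3. $F_1^{-1}-F_0^{-1}$ is non-decreasing on $(0,1)$. -/

import Mathlib

open MeasureTheory ProbabilityTheory Set
open scoped ENNReal

noncomputable section

/-- `μ ∈ P₂(ℝ)`: a Borel probability measure on `ℝ` with finite second moment. -/
structure MemP2 (μ : Measure ℝ) : Prop where
  isProbabilityMeasure : IsProbabilityMeasure μ
  second_moment_lt_top : ∫⁻ x, ‖x‖ₑ ^ 2 ∂μ < ∞

/-- `Π(μ, ν)`: the measures on `ℝ × ℝ` with marginals `μ` and `ν`. -/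
def couplings (μ ν : Measure ℝ) : Set (Measure (ℝ × ℝ)) :=
  {γ | γ.map Prod.fst = μ ∧ γ.map Prod.snd = ν}

/-- The `2`-Wasserstein distance, as the square root of the optimal transport cost (finite on
`P₂(ℝ)`). -/
def W2 (μ ν : Measure ℝ) : ℝ≥0∞ :=
  (⨅ γ ∈ couplings μ ν, ∫⁻ z, ‖z.1 - z.2‖ₑ ^ 2 ∂γ) ^ (1 / 2 : ℝ)

/-- The quantile function `F_μ⁻¹(p) = inf {x | p ≤ F_μ(x)}`, meaningful for `p ∈ (0, 1)`. -/
def quantile (μ : Measure ℝ) (p : ℝ) : ℝ :=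
  sInf {x : ℝ | p ≤ cdf μ x}

/-- The monotone coupling `(F_μ⁻¹, F_ν⁻¹)_# Unif([0, 1])`. -/
def monotoneCoupling (μ ν : Measure ℝ) : Measure (ℝ × ℝ) :=
  (volume.restrict (Icc (0 : ℝ) 1)).map (fun p => (quantile μ p, quantile ν p))

/-- `μ_t = ((1 - t) π¹ + t π²)_# γ` with `γ` the monotone coupling of `μ₀` and `μ₁`. For
`t ∈ [0, 1]` this is the geodesic between `μ₀` and `μ₁`; the formula makes sense for all `t`. -/
def displacementInterpolation (μ₀ μ₁ : Measure ℝ) (t : ℝ) : Measure ℝ :=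
  (monotoneCoupling μ₀ μ₁).map (fun z => (1 - t) * z.1 + t * z.2)

/-- A geodesic ray in `(P₂(ℝ), W₂)`: a curve `(ν_t)_{t ≥ 0}` in `P₂(ℝ)` with
`W₂(ν_t, ν_s) = |t - s| W₂(ν_0, ν_1)` for all `s, t ≥ 0`. Only the values at `t ≥ 0` matter. -/
structure IsGeodesicRay (ν : ℝ → Measure ℝ) : Prop where
  memP2 : ∀ t, 0 ≤ t → MemP2 (ν t)
  constant_speed : ∀ s t, 0 ≤ s → 0 ≤ t →
    W2 (ν t) (ν s) = ENNReal.ofReal |t - s| * W2 (ν 0) (ν 1)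

end

/-! On the line the monotone coupling is optimal, so `quantile` embeds the space isometrically into
L²(0,1) (`W2_eq_eLpNorm_quantile`), with non-decreasing functions as values. Write Q_t for the
quantile function of `ν t`. If Q₁ - Q₀ is non-decreasing, so is Q₀ + t(Q₁ - Q₀) for every t ≥ 0, and
`W2_map_unif` turns distances into L² norms along a straight line. Conversely, the equality case of
the triangle inequality in L² forces Q_t = Q₀ + t(Q₁ - Q₀) a.e. for t ≥ 1; since Q_t is monotone, a
decrease of Q₁ - Q₀ is impossible for large t. Left-continuity removes the null set. -/

/-- The uniform distribution on `[0, 1]`. -/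
noncomputable def unif : Measure ℝ := volume.restrict (Icc (0 : ℝ) 1)

instance : IsProbabilityMeasure unif :=
  ⟨by simp [unif]⟩

lemma unif_eq_restrict_Ioo : unif = volume.restrict (Ioo (0 : ℝ) 1) :=
  Measure.restrict_congr_set Ioo_ae_eq_Icc.symm

lemma ae_unif_mem_Ioo : ∀ᵐ p ∂unif, p ∈ Ioo (0 : ℝ) 1 := by
  rw [unif_eq_restrict_Ioo]
  exact ae_restrict_mem measurableSet_Ioo

lemma aemeasurable_unif_of_monotoneOn {f : ℝ → ℝ} (hf : MonotoneOn f (Ioo 0 1)) :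
    AEMeasurable f unif := by
  rw [unif_eq_restrict_Ioo]
  exact aemeasurable_restrict_of_monotoneOn measurableSet_Ioo hf

section Quantile

/-- Right-continuity of the cdf makes the infimum attained. -/
lemma quantile_le_iff (μ : Measure ℝ) {p : ℝ} (hp : p ∈ Ioo (0 : ℝ) 1) (x : ℝ) :
    quantile μ p ≤ x ↔ p ≤ cdf μ x := by
  have hbdd : BddBelow {x : ℝ | p ≤ cdf μ x} := by
    obtain ⟨b, hb⟩ := ((tendsto_cdf_atBot μ).eventually_lt_const hp.1).exists
    refine ⟨b, fun y hy => ?_⟩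
    by_contra! h
    exact absurd ((monotone_cdf μ) h.le) (not_le.2 (hb.trans_le hy))
  have hne : {x : ℝ | p ≤ cdf μ x}.Nonempty := by
    obtain ⟨b, hb⟩ := ((tendsto_cdf_atTop μ).eventually_const_lt hp.2).exists
    exact ⟨b, hb.le⟩
  refine ⟨fun h => ?_, fun h => csInf_le hbdd h⟩
  have key : ∀ y, x < y → p ≤ cdf μ y := fun y hy => by
    obtain ⟨z, hz, hzy⟩ := exists_lt_of_csInf_lt hne (lt_of_le_of_lt h hy)
    exact le_trans hz (monotone_cdf μ hzy.le)
  have hc : Filter.Tendsto (cdf μ) (nhdsWithin x (Ioi x)) (nhds (cdf μ x)) :=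
    ((cdf μ).right_continuous x).mono_left (nhdsWithin_mono _ Ioi_subset_Ici_self)
  exact ge_of_tendsto hc (by filter_upwards [self_mem_nhdsWithin] with y hy using key y hy)

lemma monotoneOn_quantile (μ : Measure ℝ) : MonotoneOn (quantile μ) (Ioo 0 1) :=
  fun _ hp _ hq hpq =>
    (quantile_le_iff μ hp _).2 (hpq.trans ((quantile_le_iff μ hq _).1 le_rfl))

lemma aemeasurable_quantile (μ : Measure ℝ) : AEMeasurable (quantile μ) unif :=
  aemeasurable_unif_of_monotoneOn (monotoneOn_quantile μ)

lemma map_quantile_unif (μ : Measure ℝ) [IsProbabilityMeasure μ] :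
    unif.map (quantile μ) = μ := by
  have := Measure.isProbabilityMeasure_map (aemeasurable_quantile μ)
  refine Measure.ext_of_Iic _ _ fun x => ?_
  rw [Measure.map_apply_of_aemeasurable (aemeasurable_quantile μ) measurableSet_Iic,
    ← ofReal_cdf μ x]
  have h : quantile μ ⁻¹' Iic x =ᵐ[unif] Iic (cdf μ x) := by
    filter_upwards [ae_unif_mem_Ioo] with p hp
    exact propext (quantile_le_iff μ hp x)
  rw [measure_congr h, unif, Measure.restrict_apply measurableSet_Iic,
    show Iic (cdf μ x) ∩ Icc 0 1 = Icc 0 (cdf μ x) from ?_, Real.volume_Icc, sub_zero]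
  ext p
  have := cdf_le_one μ x
  simp only [mem_inter_iff, mem_Iic, mem_Icc]
  exact ⟨fun h => ⟨h.2.1, h.1⟩, fun h => ⟨h.2, h.1, h.2.trans this⟩⟩

lemma tendsto_quantile_left (μ : Measure ℝ) {p : ℝ} (hp : p ∈ Ioo (0 : ℝ) 1) :
    Filter.Tendsto (quantile μ) (nhdsWithin p (Iio p)) (nhds (quantile μ p)) := by
  have hmem : ∀ᶠ q in nhdsWithin p (Iio p), q ∈ Ioo (0 : ℝ) p := Ioo_mem_nhdsLT hp.1
  refine tendsto_order.2 ⟨fun a ha => ?_, fun a ha => ?_⟩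
  · have h : cdf μ a < p := by
      by_contra! h
      exact absurd ((quantile_le_iff μ hp a).2 h) (not_le.2 ha)
    filter_upwards [hmem, Ioo_mem_nhdsLT h] with q hq hq'
    by_contra! hqa
    exact absurd ((quantile_le_iff μ ⟨hq.1, hq.2.trans hp.2⟩ a).1 hqa) (not_le.2 hq'.1)
  · filter_upwards [hmem] with q hq
    exact (monotoneOn_quantile μ ⟨hq.1, hq.2.trans hp.2⟩ hp hq.2.le).trans_lt ha

end Quantile

/-! ### Optimality of the monotone coupling. -/

section Optimality

/-- The square of a length is the area of a square, and one of the two sets is always empty. By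
Tonelli the cost becomes an integral of masses of quadrants, which can be compared one by one. -/
lemma enorm_sub_sq_eq_volume (x y : ℝ) :
    ‖x - y‖ₑ ^ 2 = volume {c : ℝ × ℝ | x ≤ min c.1 c.2 ∧ max c.1 c.2 < y} +
      volume {c : ℝ × ℝ | y ≤ min c.1 c.2 ∧ max c.1 c.2 < x} := by
  have key : ∀ x y : ℝ, volume {c : ℝ × ℝ | x ≤ min c.1 c.2 ∧ max c.1 c.2 < y} =
      ENNReal.ofReal (y - x) ^ 2 := fun x y => by
    rw [show {c : ℝ × ℝ | x ≤ min c.1 c.2 ∧ max c.1 c.2 < y} = Ico x y ×ˢ Ico x y by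
      ext c; simp only [le_min_iff, max_lt_iff, mem_ofPred_eq, mem_prod, mem_Ico]; tauto,
      Measure.volume_eq_prod, Measure.prod_prod, Real.volume_Ico, sq]
  rw [key, key, Real.enorm_eq_ofReal_abs]
  rcases le_total x y with h | h
  · rw [ENNReal.ofReal_of_nonpos (sub_nonpos.2 h), abs_sub_comm, abs_of_nonneg (sub_nonneg.2 h)]
    simp
  · rw [ENNReal.ofReal_of_nonpos (sub_nonpos.2 h), abs_of_nonneg (sub_nonneg.2 h)]
    simp

lemma measurableSet_le_and_lt {α : Type*} [MeasurableSpace α] {f g h k : α → ℝ}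
    (hf : Measurable f) (hg : Measurable g) (hh : Measurable h) (hk : Measurable k) :
    MeasurableSet {x | f x ≤ g x ∧ h x < k x} := by
  have := (measurableSet_le hf hg).inter (measurableSet_lt hh hk)
  rwa [← ofPred_and] at this

lemma lintegral_enorm_sub_sq (γ : Measure (ℝ × ℝ)) [SFinite γ] :
    ∫⁻ z, ‖z.1 - z.2‖ₑ ^ 2 ∂γ = ∫⁻ c : ℝ × ℝ,
      (γ {z | z.1 ≤ min c.1 c.2 ∧ max c.1 c.2 < z.2} +
        γ {z | z.2 ≤ min c.1 c.2 ∧ max c.1 c.2 < z.1}) := by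
  have hS : MeasurableSet {w : (ℝ × ℝ) × (ℝ × ℝ) |
      w.1.1 ≤ min w.2.1 w.2.2 ∧ max w.2.1 w.2.2 < w.1.2} :=
    measurableSet_le_and_lt (by fun_prop) (by fun_prop) (by fun_prop) (by fun_prop)
  have hT : MeasurableSet {w : (ℝ × ℝ) × (ℝ × ℝ) |
      w.1.2 ≤ min w.2.1 w.2.2 ∧ max w.2.1 w.2.2 < w.1.1} :=
    measurableSet_le_and_lt (by fun_prop) (by fun_prop) (by fun_prop) (by fun_prop)
  simp_rw [enorm_sub_sq_eq_volume]
  have hl : Measurable fun z : ℝ × ℝ =>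
      volume {c : ℝ × ℝ | z.1 ≤ min c.1 c.2 ∧ max c.1 c.2 < z.2} :=
    measurable_measure_prodMk_left hS
  have hr : Measurable fun c : ℝ × ℝ => γ {z | z.1 ≤ min c.1 c.2 ∧ max c.1 c.2 < z.2} :=
    measurable_measure_prodMk_right hS
  rw [lintegral_add_left hl, lintegral_add_left hr]
  congr 1
  · exact (Measure.prod_apply hS).symm.trans (Measure.prod_apply_symm hS)
  · exact (Measure.prod_apply hT).symm.trans (Measure.prod_apply_symm hT)

/-- A point of the left-hand set forces `{g ≤ b} ⊆ {f ≤ a}` a.e. by monotonicity; if there is none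
in `(0, 1)`, the left side vanishes. The right side depends only on the marginals and bounds the
quadrant mass of every coupling from below. -/
lemma unif_le_and_lt_le {f g : ℝ → ℝ} (hf : MonotoneOn f (Ioo 0 1))
    (hg : MonotoneOn g (Ioo 0 1)) (a b : ℝ) :
    unif {p | f p ≤ a ∧ b < g p} ≤ unif {p | f p ≤ a} - unif {p | g p ≤ b} := by
  have hgm : NullMeasurableSet {p | g p ≤ b} unif :=
    nullMeasurableSet_le (aemeasurable_unif_of_monotoneOn hg) aemeasurable_const
  by_cases h : ∃ p ∈ Ioo (0 : ℝ) 1, f p ≤ a ∧ b < g p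
  · obtain ⟨p, hp, hpa, hpb⟩ := h
    have hsub : ({p | g p ≤ b} : Set ℝ) ≤ᵐ[unif] {p | f p ≤ a} := by
      filter_upwards [ae_unif_mem_Ioo] with q hq hqb
      have hqp : q ≤ p := by
        by_contra! hpq
        exact absurd (hg hp hq hpq.le) (not_le.2 (lt_of_le_of_lt hqb hpb))
      exact (hf hq hp hqp).trans hpa
    have heq : ({p | f p ≤ a ∧ b < g p} : Set ℝ) = {p | f p ≤ a} \ {p | g p ≤ b} := by
      ext q; simp
    have hinter : unif ({p | f p ≤ a} ∩ {p | g p ≤ b}) = unif {p | g p ≤ b} := by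
      refine measure_congr ?_
      filter_upwards [hsub] with q hq
      exact propext ⟨fun h => h.2, fun h => ⟨hq h, h⟩⟩
    rw [heq, ← hinter]
    refine ENNReal.le_sub_of_add_le_right (measure_ne_top _ _) ?_
    rw [add_comm, measure_inter_add_sdiff₀ _ hgm]
  · have h0 : unif {p | f p ≤ a ∧ b < g p} = 0 := by
      refine measure_eq_zero_iff_ae_notMem.2 ?_
      filter_upwards [ae_unif_mem_Ioo] with q hq hq'
      exact h ⟨q, hq, hq'⟩
    simp [h0]

lemma lintegral_comonotone_le {f g : ℝ → ℝ} (hf : MonotoneOn f (Ioo 0 1))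
    (hg : MonotoneOn g (Ioo 0 1)) {γ : Measure (ℝ × ℝ)}
    (hγ : γ ∈ couplings (unif.map f) (unif.map g)) :
    ∫⁻ p, ‖f p - g p‖ₑ ^ 2 ∂unif ≤ ∫⁻ z, ‖z.1 - z.2‖ₑ ^ 2 ∂γ := by
  have hfm := aemeasurable_unif_of_monotoneOn hf
  have hgm := aemeasurable_unif_of_monotoneOn hg
  have : IsProbabilityMeasure (γ.map Prod.fst) :=
    hγ.1 ▸ Measure.isProbabilityMeasure_map hfm
  have : IsProbabilityMeasure γ := Measure.isProbabilityMeasure_of_map Prod.fst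
  have h1 : ∀ a, γ {z | z.1 ≤ a} = unif {p | f p ≤ a} := fun a => by
    have := congrArg (fun m => m (Iic a)) hγ.1
    simpa [Measure.map_apply measurable_fst measurableSet_Iic,
      Measure.map_apply_of_aemeasurable hfm measurableSet_Iic, preimage] using this
  have h2 : ∀ a, γ {z | z.2 ≤ a} = unif {p | g p ≤ a} := fun a => by
    have := congrArg (fun m => m (Iic a)) hγ.2
    simpa [Measure.map_apply measurable_snd measurableSet_Iic,
      Measure.map_apply_of_aemeasurable hgm measurableSet_Iic, preimage] using this
  have hmeas : Measurable fun z : ℝ × ℝ => ‖z.1 - z.2‖ₑ ^ 2 := by fun_prop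
  rw [← lintegral_map' (f := fun z : ℝ × ℝ => ‖z.1 - z.2‖ₑ ^ 2) (g := fun p => (f p, g p))
    hmeas.aemeasurable (hfm.prodMk hgm), lintegral_enorm_sub_sq, lintegral_enorm_sub_sq]
  refine lintegral_mono fun c => add_le_add ?_ ?_
  · rw [Measure.map_apply_of_aemeasurable (hfm.prodMk hgm)
      (measurableSet_le_and_lt measurable_fst measurable_const measurable_const measurable_snd)]
    refine (unif_le_and_lt_le hf hg _ _).trans ?_
    rw [← h1, ← h2]
    refine le_measure_sdiff.trans (measure_mono fun z hz => ?_)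
    simpa using hz
  · rw [Measure.map_apply_of_aemeasurable (hfm.prodMk hgm)
      (measurableSet_le_and_lt measurable_snd measurable_const measurable_const measurable_fst)]
    refine (unif_le_and_lt_le hg hf _ _).trans ?_
    rw [← h1, ← h2]
    refine le_measure_sdiff.trans (measure_mono fun z hz => ?_)
    simpa using hz

lemma eLpNorm_two_eq (h : ℝ → ℝ) (μ : Measure ℝ) :
    eLpNorm h 2 μ = (∫⁻ p, ‖h p‖ₑ ^ 2 ∂μ) ^ (1 / 2 : ℝ) := by
  simp [eLpNorm_eq_lintegral_rpow_enorm_toReal (p := 2) (by simp) (by simp)]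

lemma W2_map_unif {f g : ℝ → ℝ} (hf : MonotoneOn f (Ioo 0 1)) (hg : MonotoneOn g (Ioo 0 1)) :
    W2 (unif.map f) (unif.map g) = eLpNorm (f - g) 2 unif := by
  have hfm := aemeasurable_unif_of_monotoneOn hf
  have hgm := aemeasurable_unif_of_monotoneOn hg
  rw [eLpNorm_two_eq, W2]
  congr 1
  refine le_antisymm ?_ (le_iInf₂ fun γ hγ => lintegral_comonotone_le hf hg hγ)
  have hmem : unif.map (fun p => (f p, g p)) ∈ couplings (unif.map f) (unif.map g) :=
    ⟨AEMeasurable.map_map_of_aemeasurable measurable_fst.aemeasurable (hfm.prodMk hgm),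
      AEMeasurable.map_map_of_aemeasurable measurable_snd.aemeasurable (hfm.prodMk hgm)⟩
  refine (iInf₂_le _ hmem).trans_eq ?_
  have hmeas : Measurable fun z : ℝ × ℝ => ‖z.1 - z.2‖ₑ ^ 2 := by fun_prop
  exact lintegral_map' hmeas.aemeasurable (hfm.prodMk hgm)

lemma W2_eq_eLpNorm_quantile {μ ν : Measure ℝ} (hμ : MemP2 μ) (hν : MemP2 ν) :
    W2 μ ν = eLpNorm (quantile μ - quantile ν) 2 unif := by
  have := hμ.1
  have := hν.1
  rw [← W2_map_unif (monotoneOn_quantile μ) (monotoneOn_quantile ν), map_quantile_unif,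
    map_quantile_unif]

end Optimality

/-! ### From monotone increments to rays. -/

lemma memP2_map_unif_iff {f : ℝ → ℝ} (hf : AEMeasurable f unif) :
    MemP2 (unif.map f) ↔ MemLp f 2 unif := by
  have hmeas : Measurable fun x : ℝ => ‖x‖ₑ ^ 2 := by fun_prop
  have h : ∫⁻ x, ‖x‖ₑ ^ 2 ∂(unif.map f) = ∫⁻ p, ‖f p‖ₑ ^ 2 ∂unif :=
    lintegral_map' hmeas.aemeasurable hf
  have h2 : eLpNorm f 2 unif < ∞ ↔ ∫⁻ p, ‖f p‖ₑ ^ 2 ∂unif < ∞ := by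
    rw [eLpNorm_two_eq, ENNReal.rpow_lt_top_iff_of_pos (by norm_num)]
  exact ⟨fun H => ⟨hf.aestronglyMeasurable, h2.2 (h ▸ H.2)⟩,
    fun H => ⟨Measure.isProbabilityMeasure_map hf, h ▸ h2.1 H.2⟩⟩

lemma MemP2.memLp_quantile {μ : Measure ℝ} (hμ : MemP2 μ) : MemLp (quantile μ) 2 unif := by
  have := hμ.1
  rw [← memP2_map_unif_iff (aemeasurable_quantile μ), map_quantile_unif]
  exact hμ

lemma displacementInterpolation_eq_map_unif (μ₀ μ₁ : Measure ℝ) (t : ℝ) :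
    displacementInterpolation μ₀ μ₁ t =
      unif.map (quantile μ₀ + t • (quantile μ₁ - quantile μ₀)) := by
  have hm : Measurable fun z : ℝ × ℝ => (1 - t) * z.1 + t * z.2 := by fun_prop
  rw [displacementInterpolation, monotoneCoupling, ← unif,
    AEMeasurable.map_map_of_aemeasurable hm.aemeasurable
      ((aemeasurable_quantile μ₀).prodMk (aemeasurable_quantile μ₁))]
  congr 1
  ext p
  simp only [Function.comp_apply, Pi.add_apply, Pi.smul_apply, Pi.sub_apply, smul_eq_mul]
  ring

lemma isGeodesicRay_displacementInterpolation {μ₀ μ₁ : Measure ℝ} (h₀ : MemP2 μ₀)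
    (h₁ : MemP2 μ₁) (h : MonotoneOn (fun p => quantile μ₁ p - quantile μ₀ p) (Ioo (0 : ℝ) 1)) :
    IsGeodesicRay (displacementInterpolation μ₀ μ₁) := by
  have hmono : ∀ t : ℝ, 0 ≤ t →
      MonotoneOn (quantile μ₀ + t • (quantile μ₁ - quantile μ₀)) (Ioo 0 1) := fun t ht =>
    (monotoneOn_quantile μ₀).add fun p hp q hq hpq => mul_le_mul_of_nonneg_left (h hp hq hpq) ht
  have hW : ∀ s t : ℝ, 0 ≤ s → 0 ≤ t → W2 (displacementInterpolation μ₀ μ₁ t)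
      (displacementInterpolation μ₀ μ₁ s) =
      ENNReal.ofReal |t - s| * eLpNorm (quantile μ₁ - quantile μ₀) 2 unif := fun s t hs ht => by
    rw [displacementInterpolation_eq_map_unif, displacementInterpolation_eq_map_unif,
      W2_map_unif (hmono t ht) (hmono s hs), add_sub_add_left_eq_sub, ← sub_smul,
      eLpNorm_const_smul, Real.enorm_eq_ofReal_abs]
  refine ⟨fun t ht => ?_, fun s t hs ht => ?_⟩
  · rw [displacementInterpolation_eq_map_unif,
      memP2_map_unif_iff (aemeasurable_unif_of_monotoneOn (hmono t ht))]
    exact h₀.memLp_quantile.add ((h₁.memLp_quantile.sub h₀.memLp_quantile).const_smul t)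
  · rw [hW s t hs ht, hW 1 0 zero_le_one le_rfl]
    simp

/-! ### From rays to monotone increments. -/

/-- The equality case of the triangle inequality along a ray of a real inner product space. -/
lemma eq_smul_of_norm_eq_of_norm_sub_eq {E : Type*} [NormedAddCommGroup E]
    [InnerProductSpace ℝ E] {a b : E} {t : ℝ} (ha : ‖a‖ = t * ‖b‖)
    (hab : ‖a - b‖ = (t - 1) * ‖b‖) : a = t • b := by
  have h1 := norm_sub_sq_real a b
  have h2 := norm_sub_sq_real a (t • b)
  rw [real_inner_smul_right, norm_smul, mul_pow, Real.norm_eq_abs, sq_abs] at h2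
  rw [hab, ha] at h1
  rw [ha] at h2
  -- This combination eliminates the inner product; the remaining multiples of `‖b‖ ^ 2` cancel.
  have h3 : ‖a - t • b‖ ^ 2 = 0 := by linear_combination h2 - t * h1
  exact sub_eq_zero.1 (norm_eq_zero.1 (pow_eq_zero_iff two_ne_zero |>.1 h3))

lemma IsGeodesicRay.quantile_sub_ae_eq {ν : ℝ → Measure ℝ} (hν : IsGeodesicRay ν) {t : ℝ}
    (ht : 1 ≤ t) : quantile (ν t) - quantile (ν 0) =ᵐ[unif]
      t • (quantile (ν 1) - quantile (ν 0)) := by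
  have ht0 : 0 ≤ t := zero_le_one.trans ht
  have hQ : ∀ s, 0 ≤ s → MemLp (quantile (ν s)) 2 unif := fun s hs => (hν.memP2 s hs).memLp_quantile
  have hA := (hQ t ht0).sub (hQ 0 le_rfl)
  have hB := (hQ 1 zero_le_one).sub (hQ 0 le_rfl)
  have hAB : quantile (ν t) - quantile (ν 0) - (quantile (ν 1) - quantile (ν 0)) =
      quantile (ν t) - quantile (ν 1) := sub_sub_sub_cancel_right _ _ _
  have hW : ∀ s s' : ℝ, 0 ≤ s → 0 ≤ s' → eLpNorm (quantile (ν s') - quantile (ν s)) 2 unif =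
      ENNReal.ofReal |s' - s| * W2 (ν 0) (ν 1) := fun s s' hs hs' => by
    rw [← W2_eq_eLpNorm_quantile (hν.memP2 s' hs') (hν.memP2 s hs), hν.constant_speed s s' hs hs']
  have key : hA.toLp = t • hB.toLp := by
    apply eq_smul_of_norm_eq_of_norm_sub_eq
    · rw [Lp.norm_toLp, Lp.norm_toLp, hW 0 t le_rfl ht0, hW 0 1 le_rfl zero_le_one,
        ENNReal.toReal_mul, ENNReal.toReal_mul]
      simp [abs_of_nonneg ht0, ht0]
    · rw [← MemLp.toLp_sub, Lp.norm_toLp, Lp.norm_toLp, hAB, hW 1 t zero_le_one ht0,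
        hW 0 1 le_rfl zero_le_one, ENNReal.toReal_mul, ENNReal.toReal_mul]
      simp [abs_of_nonneg (sub_nonneg.2 ht), ht]
  rw [← MemLp.toLp_const_smul] at key
  exact (MemLp.toLp_eq_toLp_iff _ _).1 key

/-- Every left neighbourhood of `p` has positive mass, so it meets a set of full measure. -/
lemma exists_mem_of_ae_unif {P Q : ℝ → Prop} (hP : ∀ᵐ p ∂unif, P p) {p : ℝ}
    (hp : p ∈ Ioo (0 : ℝ) 1) (hQ : ∀ᶠ q in nhdsWithin p (Iio p), Q q) : ∃ q, P q ∧ Q q := by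
  obtain ⟨l, hl, hlQ⟩ := (mem_nhdsLT_iff_exists_Ioo_subset' hp.1).1
    (hQ.and (Ioo_mem_nhdsLT hp.1))
  by_contra! H
  have h0 : unif (Ioo l p) = 0 := by
    refine measure_eq_zero_iff_ae_notMem.2 ?_
    filter_upwards [hP] with q hq hq'
    exact H q hq (hlQ hq').1
  have hsub : Ioo l p ⊆ Icc 0 1 := fun q hq =>
    ⟨(hlQ hq).2.1.le, (hq.2.trans hp.2).le⟩
  rw [unif, Measure.restrict_apply measurableSet_Ioo, inter_eq_left.2 hsub, Real.volume_Ioo] at h0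
  have := ENNReal.ofReal_eq_zero.1 h0
  have : l < p := hl
  linarith

/-- A left-continuous function which is monotone on a set of full measure is monotone. -/
lemma monotoneOn_of_ae_of_tendsto_left {D : ℝ → ℝ} {P : ℝ → Prop} (hP : ∀ᵐ p ∂unif, P p)
    (hD : ∀ p q, P p → P q → p ≤ q → D p ≤ D q)
    (hc : ∀ p ∈ Ioo (0 : ℝ) 1, Filter.Tendsto D (nhdsWithin p (Iio p)) (nhds (D p))) :
    MonotoneOn D (Ioo 0 1) := by
  intro p hp q hq hpq
  rcases hpq.eq_or_lt with rfl | hpq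
  · exact le_rfl
  by_contra! hlt
  obtain ⟨c, hqc, hcp⟩ := exists_between hlt
  obtain ⟨p', hPp, hp', hp'p⟩ := exists_mem_of_ae_unif hP hp
    (((hc p hp).eventually_const_lt hcp).and self_mem_nhdsWithin)
  obtain ⟨q', hPq, hq', hpq'⟩ := exists_mem_of_ae_unif hP hq
    -- Taking `q'` in `(p, q)` ensures `p' < q'`, although `D p' > c > D q'`.
    (((hc q hq).eventually_lt_const hqc).and (Ioo_mem_nhdsLT hpq))
  have := hD p' q' hPp hPq (hp'p.le.trans hpq'.1.le)
  linarith

lemma IsGeodesicRay.monotoneOn_quantile_sub {ν : ℝ → Measure ℝ} (hν : IsGeodesicRay ν) :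
    MonotoneOn (fun p => quantile (ν 1) p - quantile (ν 0) p) (Ioo (0 : ℝ) 1) := by
  -- Integer times suffice and leave a single null set; `n + 1` keeps the time at least 1.
  have hae : ∀ᵐ p ∂unif, p ∈ Ioo (0 : ℝ) 1 ∧ ∀ n : ℕ,
      quantile (ν (n + 1)) p - quantile (ν 0) p =
        (n + 1) * (quantile (ν 1) p - quantile (ν 0) p) :=
    ae_unif_mem_Ioo.and (ae_all_iff.2 fun n => hν.quantile_sub_ae_eq (by simp))
  refine monotoneOn_of_ae_of_tendsto_left hae (fun p q hp hq hpq => ?_)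
    fun p hp => (tendsto_quantile_left _ hp).sub (tendsto_quantile_left _ hp)
  by_contra! hlt
  -- For this `n`, `n` times the drop of Q₁ - Q₀ from `p` to `q` exceeds the growth of Q₀, so the
  -- quantile function at time `n + 1` would decrease.
  obtain ⟨n, hn⟩ := exists_nat_gt ((quantile (ν 0) q - quantile (ν 0) p) /
    ((quantile (ν 1) p - quantile (ν 0) p) - (quantile (ν 1) q - quantile (ν 0) q)))
  rw [div_lt_iff₀ (sub_pos.2 hlt)] at hn
  have hmono := monotoneOn_quantile (ν (n + 1)) hp.1 hq.1 hpq
  have h1 := hp.2 n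
  have h2 := hq.2 n
  nlinarith

theorem proposition2 (μ₀ μ₁ : Measure ℝ) (h₀ : MemP2 μ₀) (h₁ : MemP2 μ₁) :
    ((∃ ν : ℝ → Measure ℝ, IsGeodesicRay ν ∧
        ∀ t ∈ Icc (0 : ℝ) 1, ν t = displacementInterpolation μ₀ μ₁ t) ↔
      MonotoneOn (fun p => quantile μ₁ p - quantile μ₀ p) (Ioo (0 : ℝ) 1)) ∧
    (IsGeodesicRay (displacementInterpolation μ₀ μ₁) ↔
      MonotoneOn (fun p => quantile μ₁ p - quantile μ₀ p) (Ioo (0 : ℝ) 1)) := by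
  have := h₀.1
  have := h₁.1
  have hd0 : displacementInterpolation μ₀ μ₁ 0 = μ₀ := by
    rw [displacementInterpolation_eq_map_unif, zero_smul, add_zero, map_quantile_unif]
  have hd1 : displacementInterpolation μ₀ μ₁ 1 = μ₁ := by
    rw [displacementInterpolation_eq_map_unif, one_smul, add_sub_cancel, map_quantile_unif]
  have hray : (∃ ν : ℝ → Measure ℝ, IsGeodesicRay ν ∧
      ∀ t ∈ Icc (0 : ℝ) 1, ν t = displacementInterpolation μ₀ μ₁ t) →
      MonotoneOn (fun p => quantile μ₁ p - quantile μ₀ p) (Ioo (0 : ℝ) 1) := by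
    rintro ⟨ν, hν, hext⟩
    have h := hν.monotoneOn_quantile_sub
    rwa [hext 0 (by simp), hext 1 (by simp), hd0, hd1] at h
  exact ⟨⟨hray, fun h => ⟨_, isGeodesicRay_displacementInterpolation h₀ h₁ h, fun _ _ => rfl⟩⟩,
    ⟨fun h => hray ⟨_, h, fun _ _ => rfl⟩, isGeodesicRay_displacementInterpolation h₀ h₁⟩⟩
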